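/- Let $H^A_n$ and $H^B_n$ ($n=0,1,2,\dots$) be complex Hilbert spaces, the spaces of states of Alice and of Bob with exactly $n$ particles. Let $\hat N_A$ and $\hat N_B$ be the particle number operators on the local spaces $H^A=\bigoplus_{n\ge 0}H^A_n$ and $H^B=\bigoplus_{n\ge 0}H^B_n$, acting on the $n$-particle sector as multiplication by $n$. Fix a total particle number $N$, and let a pure state mean a unit vector $\psi=\bigoplus_{n=0}^N\psi^n$ of finite Schmidt rank with $\psi^n\in H^A_n\otimes H^B_{N-n}$. Its Schmidt coefficients are the vectors $\vec\lambda^n=(\lambda^n_1\ge\lambda^n_2\ge\dots\ge 0)$, $0\le n\le N$, padded by zeros, for which $\psi^n=\sum_i\sqrt{\lambda^n_i}\,e^n_i\otimes f^n_i$ with orthonormal $(e^n_i)_i$ in $H^A_n$ and orthonormal $(f^n_i)_i$ in $H^B_{N-n}$; here $n$ is Alice's local particle number. An LOCC protocol respecting the superselection rule (SSR) consists of finitely many rounds. In each round one party performs a measurement on its own system with finitely many Kraus operators $M_i$, $\sum_i M_i^\dagger M_i=1$, each commuting with that party's particle number operator, and communicates the result, on which the later rounds may depend; every branch of the protocol ends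 by announcing a label $\alpha$ from a finite set. A state $\psi$ can be converted into the ensemble $\{p_\alpha,\phi_\alpha\}$ if some such protocol, started in $\psi$, announces $\alpha$ with probability $p_\alpha$ for every $\alpha$, and, up to a phase, leaves the system in the state $\phi_\alpha$ in every branch of nonzero probability announcing $\alpha$. For finitely supported nonincreasing sequences write $x\prec y$ if $\sum_{i\le k}x_i\le\sum_{i\le k}y_i$ for all $k$ and $\sum_i x_i=\sum_i y_i$. **Theorem.** Let $\psi$ be a pure state with Schmidt coefficients $\{\vec\lambda^n\}$, let $\{p_\alpha\}$ be a finite probability distribution, and let $\phi_\alpha$ be pure states, with the same total particle number $N$, with Schmidt coefficients $\{\vec\mu^n_\alpha\}$. Then $\psi$ can be converted into the ensemble $\{p_\alpha,\phi_\alpha\}$ by LOCC respecting the SSR if and only if $$\vec\lambda^n\prec\sum_\alpha p_\alpha\,\vec\mu^n_\alpha\qquad\text{for every } n=0,\dots,N.$$ -/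

import Mathlib

open scoped TensorProduct

noncomputable section

namespace SSR

universe u v w

section Local

/-- A local system: `H n` is the Hilbert space of its states with exactly `n` particles, and the
full local Hilbert space is the Hilbert direct sum `⨁_{n ≥ 0} H n`. -/
abbrev LocalSpace (H : ℕ → Type u) [∀ n, NormedAddCommGroup (H n)] : Type u := lp H 2

variable {H : ℕ → Type u} [∀ n, NormedAddCommGroup (H n)] [∀ n, InnerProductSpace ℂ (H n)]

/-- The graph of the (unbounded, self-adjoint) particle number operator `N̂`: `x` lies in the domain
of `N̂` and `N̂ x = y`. -/
def NumberOperatorMaps (x y : LocalSpace H) : Prop :=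
  ∀ n : ℕ, y n = (n : ℂ) • x n

/-- The bounded operator `M` commutes with the particle number operator: `M` maps the domain of `N̂`
into itself and `N̂ (M x) = M (N̂ x)` there. -/
def CommutesWithNumber (M : LocalSpace H →L[ℂ] LocalSpace H) : Prop :=
  ∀ x y : LocalSpace H, NumberOperatorMaps x y → NumberOperatorMaps (M x) (M y)

/-- The diagonal block `H n → H n` of `M`. -/
def block (M : LocalSpace H →L[ℂ] LocalSpace H) (n : ℕ) : H n →ₗ[ℂ] H n where
  toFun x := M (lp.single 2 n x) n
  map_add' x y := by simp [lp.single_add]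
  map_smul' c x := by simp [lp.single_smul]

/-- The Kraus operators `M 0, …, M (k - 1)` form a local measurement obeying the superselection
rule: `∑ᵢ Mᵢ† Mᵢ = 1`, and every `Mᵢ` commutes with the local particle number operator. -/
structure IsMeasurement [∀ n, CompleteSpace (H n)] {k : ℕ}
    (M : Fin k → LocalSpace H →L[ℂ] LocalSpace H) : Prop where
  complete : ∑ i, (ContinuousLinearMap.adjoint (M i)) ∘L (M i) =
    ContinuousLinearMap.id ℂ (LocalSpace H)
  commutes : ∀ i, CommutesWithNumber (M i)

end Local

section Bipartite

variable (HA : ℕ → Type u) [∀ n, NormedAddCommGroup (HA n)] [∀ n, InnerProductSpace ℂ (HA n)]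
variable (HB : ℕ → Type v) [∀ n, NormedAddCommGroup (HB n)] [∀ n, InnerProductSpace ℂ (HB n)]

/-- The (unnormalised) pure states of finite Schmidt rank with `N` particles in total: elements of
`⨁_{n=0}^N HA n ⊗ HB (N - n)`, where `n` is the particle number of Alice. -/
abbrev Vec (N : ℕ) : Type (max u v) :=
  ∀ n : Fin (N + 1), HA n ⊗[ℂ] HB (N - n)

variable {HA HB}

/-- The squared Hilbert space norm of a vector of the direct sum. -/
def normSq {N : ℕ} (ψ : Vec HA HB N) : ℝ := ∑ n, ‖ψ n‖ ^ 2

/-- `(M ⊗ 1) ψ` for an operator `M` of Alice that commutes with her particle number. -/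
def actA {N : ℕ} (M : LocalSpace HA →L[ℂ] LocalSpace HA) (ψ : Vec HA HB N) : Vec HA HB N :=
  fun n => TensorProduct.map (block M n) LinearMap.id (ψ n)

/-- `(1 ⊗ M) ψ` for an operator `M` of Bob that commutes with his particle number. -/
def actB {N : ℕ} (M : LocalSpace HB →L[ℂ] LocalSpace HB) (ψ : Vec HA HB N) : Vec HA HB N :=
  fun n => TensorProduct.map LinearMap.id (block M (N - n)) (ψ n)

/-- `c` is the nonincreasing sequence, padded by zeros, of the Schmidt coefficients of `v`:
`v = ∑ᵢ √(c i) eᵢ ⊗ fᵢ` with orthonormal families `e` and `f`. -/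
def HasSchmidtCoeffs {E : Type u} {F : Type v} [NormedAddCommGroup E] [InnerProductSpace ℂ E]
    [NormedAddCommGroup F] [InnerProductSpace ℂ F] (v : E ⊗[ℂ] F) (c : ℕ →₀ ℝ) : Prop :=
  Antitone c ∧ (∀ i, 0 ≤ c i) ∧
    ∃ (r : ℕ) (e : Fin r → E) (f : Fin r → F), Orthonormal ℂ e ∧ Orthonormal ℂ f ∧
      c.support ⊆ Finset.range r ∧
      v = ∑ i : Fin r, ((Real.sqrt (c i) : ℝ) : ℂ) • (e i ⊗ₜ[ℂ] f i)

end Bipartite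

/-- Majorization `x ≺ y` of finitely supported nonincreasing sequences of nonnegative reals. -/
def Majorized (x y : ℕ →₀ ℝ) : Prop :=
  (∀ k : ℕ, ∑ i ∈ Finset.range k, x i ≤ ∑ i ∈ Finset.range k, y i) ∧
    x.sum (fun _ t => t) = y.sum (fun _ t => t)

section LOCC

variable (HA : ℕ → Type u) [∀ n, NormedAddCommGroup (HA n)] [∀ n, InnerProductSpace ℂ (HA n)]
  [∀ n, CompleteSpace (HA n)]
variable (HB : ℕ → Type v) [∀ n, NormedAddCommGroup (HB n)] [∀ n, InnerProductSpace ℂ (HB n)]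
  [∀ n, CompleteSpace (HB n)]

/-- LOCC protocols respecting the superselection rule, with final classical outcome in `ι`. Either
the protocol halts and announces an outcome, or one party performs a local measurement obeying the
superselection rule and communicates its result `i`, on which the rest of the protocol depends. -/
inductive Protocol (ι : Type w) : Type (max u v w)
  | halt (α : ι) : Protocol ι
  | alice (k : ℕ) (M : Fin k → LocalSpace HA →L[ℂ] LocalSpace HA) (hM : IsMeasurement M)
      (next : Fin k → Protocol ι) : Protocol ι
  | bob (k : ℕ) (M : Fin k → LocalSpace HB →L[ℂ] LocalSpace HB) (hM : IsMeasurement M)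
      (next : Fin k → Protocol ι) : Protocol ι

variable {HA HB}

open Classical in
/-- The probability that the protocol, started in the state `ψ`, announces the outcome `α`: the sum
of `‖v‖ ^ 2` over all branches announcing `α`, where `v` is the unnormalised final state of the
branch (the product of the Kraus operators along the branch, applied to `ψ`). -/
def Protocol.prob {ι : Type w} {N : ℕ} : Protocol HA HB ι → Vec HA HB N → ι → ℝ
  | .halt β, ψ, α => if β = α then normSq ψ else 0
  | .alice _ M _ next, ψ, α => ∑ i, (next i).prob (actA (M i) ψ) α
  | .bob _ M _ next, ψ, α => ∑ i, (next i).prob (actB (M i) ψ) α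

/-- In every branch of the protocol, started in `ψ`, the unnormalised final state is a multiple
`c • φ α` of the state `φ α` that belongs to the announced outcome `α` (with `c = 0` exactly for the
branches of probability zero, when `φ α` is normalised). -/
def Protocol.EndsIn {ι : Type w} {N : ℕ} (φ : ι → Vec HA HB N) :
    Protocol HA HB ι → Vec HA HB N → Prop
  | .halt α, ψ => ∃ c : ℂ, ψ = c • φ α
  | .alice _ M _ next, ψ => ∀ i, (next i).EndsIn φ (actA (M i) ψ)
  | .bob _ M _ next, ψ => ∀ i, (next i).EndsIn φ (actB (M i) ψ)

/-- `ψ` can be converted into the ensemble `{p α, φ α}` by LOCC respecting the superselection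
rule. -/
def Convertible {ι : Type w} {N : ℕ} (ψ : Vec HA HB N) (p : ι → ℝ) (φ : ι → Vec HA HB N) : Prop :=
  ∃ π : Protocol HA HB ι, π.EndsIn φ ψ ∧ ∀ α, π.prob ψ α = p α

end LOCC

end SSR

end

/-! Operators commuting with the particle number are block diagonal, so a protocol acts on each
sector `n` by ordinary local measurements, with the same outcomes for all sectors.

Necessity is Ky Fan's principle: the sum of the `k` largest Schmidt coefficients of `v` is the
maximum of `|⟨w, v⟩|²` over unit vectors `w` of tensor rank at most `k`. No local measurement
decreases this quantity on average (`IsKyFanBound.of_left`, `IsKyFanBound.of_right`), and induction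
on the protocol gives the partial-sum inequalities in every sector. They include an inequality
between total weights; over all sectors both sides add up to 1, so each of these is an equality.

Sufficiency takes one measurement by Alice and a rotation by Bob. By `exists_permutation_mixture`,
`λⁿ = ∑ₛ qₛ ∑_α p_α μⁿ_α ∘ σₛⁿ`, with weights `q` common to all sectors; a Kraus operator acts on
the whole superposition, so separate weights for each sector would not do. For the outcome `(s, α)`
Alice sends `eⁿᵢ` to the Schmidt vector of `φ_α` with index `σₛⁿ i`, scaled by `√(qₛ p_α μⁿ_α(σₛⁿ i)
/ λⁿᵢ)`; completeness is the mixture identity. Bob then rotates `fⁿᵢ` to the matching Schmidt vector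
(`convertible_of_bob_rotation`). -/

namespace SSR

/-! ### Ky Fan's principle for Schmidt coefficients, and its behaviour under local measurements. -/

section KyFan

variable {E F : Type*} [NormedAddCommGroup E] [InnerProductSpace ℂ E]
  [NormedAddCommGroup F] [InnerProductSpace ℂ F]

theorem inner_tensor_smul_left (c : ℂ) (x y : E ⊗[ℂ] F) :
    inner ℂ (c • x) y = starRingEnd ℂ c * inner ℂ x y :=
  inner_smul_left x y c

theorem inner_tensor_smul_right (c : ℂ) (x y : E ⊗[ℂ] F) :
    inner ℂ x (c • y) = c * inner ℂ x y :=
  inner_smul_right x y c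

/-- The vector `w` is a sum of at most `k` pure tensors. -/
def TensorRankLE (k : ℕ) (w : E ⊗[ℂ] F) : Prop :=
  ∃ d ≤ k, ∃ (a : Fin d → E) (b : Fin d → F), w = ∑ j, a j ⊗ₜ[ℂ] b j

/-- The constant `C` bounds the squared overlap of `v` with every unit vector of tensor rank at
most `k`. -/
def IsKyFanBound (k : ℕ) (v : E ⊗[ℂ] F) (C : ℝ) : Prop :=
  ∀ w, TensorRankLE k w → ‖inner ℂ w v‖ ^ 2 ≤ ‖w‖ ^ 2 * C

theorem TensorRankLE.comm {k : ℕ} {w : E ⊗[ℂ] F} (h : TensorRankLE k w) :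
    TensorRankLE k (TensorProduct.comm ℂ E F w) := by
  obtain ⟨d, hd, a, b, rfl⟩ := h
  exact ⟨d, hd, b, a, by simp⟩

theorem IsKyFanBound.comm {k : ℕ} {v : E ⊗[ℂ] F} {C : ℝ} (h : IsKyFanBound k v C) :
    IsKyFanBound k (TensorProduct.comm ℂ E F v) C := by
  intro w hw
  have h1 := h _ hw.comm
  have h2 : inner ℂ (TensorProduct.comm ℂ F E w) v
      = inner ℂ w (TensorProduct.comm ℂ E F v) := by
    rw [← TensorProduct.inner_comm_comm]
    simp
  rwa [h2, TensorProduct.norm_comm] at h1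

/-- Both sides are sesquilinear in `(x, y)`, so pure tensors decide. This transfers identities
between local operators to the tensor product without taking adjoints. -/
theorem inner_map_sum {E₁ E₂ F₁ F₂ κ : Type*} [Fintype κ]
    [NormedAddCommGroup E₁] [InnerProductSpace ℂ E₁] [NormedAddCommGroup E₂]
    [InnerProductSpace ℂ E₂] [NormedAddCommGroup F₁] [InnerProductSpace ℂ F₁]
    [NormedAddCommGroup F₂] [InnerProductSpace ℂ F₂]
    (A A' : κ → E →ₗ[ℂ] E₁) (B B' : κ → F →ₗ[ℂ] F₁) (C C' : E →ₗ[ℂ] E₂) (D D' : F →ₗ[ℂ] F₂)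
    (h : ∀ a a' b b', ∑ i, inner ℂ (A i a) (A' i a') * inner ℂ (B i b) (B' i b')
      = inner ℂ (C a) (C' a') * inner ℂ (D b) (D' b')) (x y : E ⊗[ℂ] F) :
    ∑ i, inner ℂ (TensorProduct.map (A i) (B i) x) (TensorProduct.map (A' i) (B' i) y)
      = inner ℂ (TensorProduct.map C D x) (TensorProduct.map C' D' y) := by
  induction x using TensorProduct.induction_on with
  | zero => simp
  | add x₁ x₂ h₁ h₂ => simp only [map_add, inner_add_left, Finset.sum_add_distrib, h₁, h₂]
  | tmul a b =>
    induction y using TensorProduct.induction_on with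
    | zero => simp
    | add y₁ y₂ h₁ h₂ => simp only [map_add, inner_add_right, Finset.sum_add_distrib, h₁, h₂]
    | tmul a' b' => simpa using h a a' b b'

/-- The orthogonal projection on the span of an orthonormal family. -/
noncomputable def projFamily {d : ℕ} (u : Fin d → E) : E →ₗ[ℂ] E :=
  ∑ j, (InnerProductSpace.rankOne ℂ (u j) (u j)).toLinearMap

theorem projFamily_apply {d : ℕ} (u : Fin d → E) (x : E) :
    projFamily u x = ∑ j, inner ℂ (u j) x • u j := by
  simp [projFamily]

theorem projFamily_self {d : ℕ} {u : Fin d → E} (hu : Orthonormal ℂ u) (j : Fin d) :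
    projFamily u (u j) = u j := by
  classical
  simp [projFamily_apply, orthonormal_iff_ite.mp hu]

theorem inner_projFamily_left {d : ℕ} (u : Fin d → E) (x y : E) :
    inner ℂ (projFamily u x) y = ∑ j, inner ℂ x (u j) * inner ℂ (u j) y := by
  simp [projFamily_apply, mul_comm]

theorem inner_projFamily_symm {d : ℕ} (u : Fin d → E) (x y : E) :
    inner ℂ (projFamily u x) y = inner ℂ x (projFamily u y) := by
  rw [inner_projFamily_left, projFamily_apply, inner_sum]
  simp [inner_smul_right, mul_comm]

theorem projFamily_idem {d : ℕ} {u : Fin d → E} (hu : Orthonormal ℂ u) (x : E) :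
    projFamily u (projFamily u x) = projFamily u x := by
  conv_lhs => rw [projFamily_apply u x]
  simp [projFamily_self hu, projFamily_apply u x]

/-- The `E`-factors of `w` span a space of dimension at most `k`; `u` is an orthonormal basis of it.
Overlaps with `w` thereby become norms of projections. -/
theorem TensorRankLE.exists_projFamily {k : ℕ} {w : E ⊗[ℂ] F} (h : TensorRankLE k w) :
    ∃ d ≤ k, ∃ u : Fin d → E, Orthonormal ℂ u ∧
      TensorProduct.map (projFamily u) LinearMap.id w = w := by
  obtain ⟨d, hd, a, b, rfl⟩ := h
  let S := Submodule.span ℂ (Set.range a)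
  have : FiniteDimensional ℂ S := FiniteDimensional.span_of_finite ℂ (Set.finite_range a)
  let β := stdOrthonormalBasis ℂ S
  have hS : Module.finrank ℂ S ≤ d := by
    simpa [S, Set.finrank] using finrank_range_le_card (R := ℂ) a
  refine ⟨_, hS.trans hd, fun j => (β j : E), ?_, ?_⟩
  · exact β.orthonormal.comp_linearIsometry S.subtypeₗᵢ
  · simp only [map_sum, TensorProduct.map_tmul, LinearMap.id_apply]
    refine Finset.sum_congr rfl fun j _ => ?_
    congr 1
    have hj : a j ∈ S := Submodule.subset_span ⟨j, rfl⟩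
    have := congrArg (Submodule.subtype S) (β.sum_repr' ⟨a j, hj⟩)
    simpa [projFamily_apply] using this

theorem tensorRankLE_map_projFamily {d k : ℕ} (hd : d ≤ k) (u : Fin d → E) (x : E ⊗[ℂ] F) :
    TensorRankLE k (TensorProduct.map (projFamily u) LinearMap.id x) := by
  refine ⟨d, hd, u, fun j => TensorProduct.lid ℂ F
    (TensorProduct.map (innerSL ℂ (u j)).toLinearMap LinearMap.id x), ?_⟩
  induction x using TensorProduct.induction_on with
  | zero => simp
  | add x y hx hy => simp only [map_add, hx, hy, TensorProduct.tmul_add, Finset.sum_add_distrib]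
  | tmul a b => simp [projFamily_apply, TensorProduct.sum_tmul, TensorProduct.smul_tmul]

theorem inner_map_projFamily_self {d : ℕ} {u : Fin d → E} (hu : Orthonormal ℂ u)
    (x y : E ⊗[ℂ] F) :
    inner ℂ (TensorProduct.map (projFamily u) LinearMap.id x)
      (TensorProduct.map (projFamily u) LinearMap.id y)
      = inner ℂ (TensorProduct.map (projFamily u) LinearMap.id x) y := by
  have h := inner_map_sum (κ := Unit) (fun _ => projFamily u) (fun _ => projFamily u)
    (fun _ => (LinearMap.id : F →ₗ[ℂ] F)) (fun _ => (LinearMap.id : F →ₗ[ℂ] F))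
    (projFamily u) LinearMap.id LinearMap.id LinearMap.id
    (fun a a' b b' => by
      simp [← inner_projFamily_symm, projFamily_idem hu]) x y
  simpa using h

theorem norm_inner_sq_le_of_fixed {d : ℕ} {u : Fin d → E} (hu : Orthonormal ℂ u)
    {w : E ⊗[ℂ] F} (hw : TensorProduct.map (projFamily u) LinearMap.id w = w) (v : E ⊗[ℂ] F) :
    ‖inner ℂ w v‖ ^ 2
      ≤ ‖w‖ ^ 2 * ‖TensorProduct.map (projFamily u) LinearMap.id v‖ ^ 2 := by
  have h : inner ℂ w v = inner ℂ w (TensorProduct.map (projFamily u) LinearMap.id v) := by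
    have := inner_map_projFamily_self hu w v
    rw [hw] at this
    exact this.symm
  rw [h, ← mul_pow]
  exact pow_le_pow_left₀ (norm_nonneg _) (norm_inner_le_norm (𝕜 := ℂ) (E := E ⊗[ℂ] F) _ _) 2

/-- The projection `P` attached to a test vector acts on the other factor, so it commutes with every
`B i`, and `‖P v‖² = ∑ᵢ ‖P Bᵢ v‖²`. Each `P Bᵢ v` is itself a test vector, whose overlap with `Bᵢ v`
is `‖P Bᵢ v‖²`; the bound for `Bᵢ v` thus gives `‖P Bᵢ v‖² ≤ Cᵢ`. -/
theorem IsKyFanBound.of_right {κ : Type*} [Fintype κ] {k : ℕ} {v : E ⊗[ℂ] F}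
    {B : κ → F →ₗ[ℂ] F} {C : κ → ℝ} (hB : ∀ b b', ∑ i, inner ℂ (B i b) (B i b') = inner ℂ b b')
    (hC : ∀ i, 0 ≤ C i) (hv : ∀ i, IsKyFanBound k (TensorProduct.map LinearMap.id (B i) v) (C i)) :
    IsKyFanBound k v (∑ i, C i) := by
  intro w hw
  obtain ⟨d, hd, u, hu, huw⟩ := hw.exists_projFamily
  refine (norm_inner_sq_le_of_fixed hu huw v).trans
    (mul_le_mul_of_nonneg_left ?_ (sq_nonneg _))
  set P := TensorProduct.map (projFamily u) (LinearMap.id : F →ₗ[ℂ] F)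
  have hcomm : ∀ i (x : E ⊗[ℂ] F), TensorProduct.map LinearMap.id (B i) (P x)
      = P (TensorProduct.map LinearMap.id (B i) x) := by
    intro i x
    simp only [P, ← LinearMap.comp_apply, ← TensorProduct.map_comp, LinearMap.comp_id,
      LinearMap.id_comp]
  have h1 : ‖P v‖ ^ 2 = ∑ i, ‖P (TensorProduct.map LinearMap.id (B i) v)‖ ^ 2 := by
    have h := inner_map_sum (fun _ => (LinearMap.id : E →ₗ[ℂ] E)) (fun _ => LinearMap.id) B B
      LinearMap.id LinearMap.id LinearMap.id LinearMap.id
      (fun a a' b b' => by simp [← Finset.mul_sum, hB]) (P v) (P v)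
    simp only [hcomm, TensorProduct.map_id, LinearMap.id_apply,
      inner_self_eq_norm_sq_to_K (𝕜 := ℂ) (E := E ⊗[ℂ] F)] at h
    exact_mod_cast h.symm
  rw [h1]
  refine Finset.sum_le_sum fun i _ => ?_
  set x := TensorProduct.map LinearMap.id (B i) v
  have h2 := hv i (P x) (tensorRankLE_map_projFamily hd u x)
  have h3 : inner ℂ (P x) x = ((‖P x‖ ^ 2 : ℝ) : ℂ) := by
    rw [← inner_map_projFamily_self hu, inner_self_eq_norm_sq_to_K (𝕜 := ℂ) (E := E ⊗[ℂ] F)]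
    simp [P]
  change ‖inner ℂ (P x) x‖ ^ 2 ≤ _ at h2
  rw [h3, Complex.norm_real, Real.norm_of_nonneg (sq_nonneg _), sq] at h2
  rcases (sq_nonneg ‖P x‖).eq_or_lt with h | h
  · exact h ▸ hC i
  · exact le_of_mul_le_mul_left h2 h

theorem IsKyFanBound.of_left {κ : Type*} [Fintype κ] {k : ℕ} {v : E ⊗[ℂ] F}
    {B : κ → E →ₗ[ℂ] E} {C : κ → ℝ} (hB : ∀ b b', ∑ i, inner ℂ (B i b) (B i b') = inner ℂ b b')
    (hC : ∀ i, 0 ≤ C i) (hv : ∀ i, IsKyFanBound k (TensorProduct.map (B i) LinearMap.id v) (C i)) :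
    IsKyFanBound k v (∑ i, C i) := by
  have h : IsKyFanBound k (TensorProduct.comm ℂ E F v) (∑ i, C i) := by
    refine IsKyFanBound.of_right hB hC fun i => ?_
    have := (hv i).comm
    rwa [← TensorProduct.map_comm] at this
  simpa using h.comm

theorem sum_mul_le_sum_range {μ t : ℕ → ℝ} (hμ : Antitone μ) (hμ0 : ∀ i, 0 ≤ μ i)
    (ht0 : ∀ i, 0 ≤ t i) (ht1 : ∀ i, t i ≤ 1) (k r : ℕ) (ht : ∑ i ∈ Finset.range r, t i ≤ k) :
    ∑ i ∈ Finset.range r, μ i * t i ≤ ∑ i ∈ Finset.range k, μ i := by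
  -- With `μ k` as threshold, `(μ i - μ k) t i` is at most the positive part of `μ i - μ k`.
  have h1 : ∀ i ∈ Finset.range r, μ i * t i ≤ μ k * t i + if i < k then μ i - μ k else 0 := by
    intro i _
    split_ifs with h
    · nlinarith [hμ h.le, ht1 i]
    · nlinarith [hμ (not_lt.mp h), ht0 i]
  refine (Finset.sum_le_sum h1).trans ?_
  rw [Finset.sum_add_distrib, ← Finset.mul_sum, ← Finset.sum_filter]
  have h2 : ∑ i ∈ Finset.range r with i < k, (μ i - μ k)
      ≤ ∑ i ∈ Finset.range k, (μ i - μ k) := by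
    refine Finset.sum_le_sum_of_subset_of_nonneg ?_ ?_
    · intro i hi
      simpa using (Finset.mem_filter.mp hi).2
    · intro i hi _
      exact sub_nonneg.mpr (hμ (Finset.mem_range.mp hi).le)
  rw [Finset.sum_sub_distrib (s := Finset.range k), Finset.sum_const, Finset.card_range, nsmul_eq_mul] at h2
  nlinarith [mul_le_mul_of_nonneg_left ht (hμ0 k)]

theorem norm_projFamily_sq {d : ℕ} {u : Fin d → E} (hu : Orthonormal ℂ u) (x : E) :
    ‖projFamily u x‖ ^ 2 = ∑ j, ‖inner ℂ (u j) x‖ ^ 2 := by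
  have h : ((‖projFamily u x‖ ^ 2 : ℝ) : ℂ) = ((∑ j, ‖inner ℂ (u j) x‖ ^ 2 : ℝ) : ℂ) := by
    push_cast
    have := inner_self_eq_norm_sq_to_K (𝕜 := ℂ) (projFamily u x)
    rw [inner_projFamily_symm, projFamily_idem hu, ← inner_projFamily_symm,
      inner_projFamily_left] at this
    refine Eq.trans this.symm (Finset.sum_congr rfl fun j _ => ?_)
    rw [← inner_conj_symm, RCLike.conj_mul]
    rfl
  exact_mod_cast h

theorem norm_sq_sum_smul_tmul {d : ℕ} {f : Fin d → F} (hf : Orthonormal ℂ f) {c : Fin d → ℝ}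
    (hc : ∀ i, 0 ≤ c i) (x : Fin d → E) :
    ‖∑ i, ((Real.sqrt (c i) : ℝ) : ℂ) • (x i ⊗ₜ[ℂ] f i)‖ ^ 2 = ∑ i, c i * ‖x i‖ ^ 2 := by
  classical
  have h := inner_self_eq_norm_sq_to_K (𝕜 := ℂ) (E := E ⊗[ℂ] F)
    (∑ i, ((Real.sqrt (c i) : ℝ) : ℂ) • (x i ⊗ₜ[ℂ] f i))
  simp only [sum_inner, inner_sum, inner_tensor_smul_left, inner_tensor_smul_right,
    TensorProduct.inner_tmul, orthonormal_iff_ite.mp hf, mul_ite, mul_one, mul_zero, Finset.sum_ite_eq', Finset.mem_univ,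
    if_true, inner_self_eq_norm_sq_to_K (𝕜 := ℂ) (E := E), Complex.conj_ofReal] at h
  have h2 : ∀ i, ((Real.sqrt (c i) : ℝ) : ℂ) * (((Real.sqrt (c i) : ℝ) : ℂ) * (‖x i‖ : ℂ) ^ 2)
      = ((c i * ‖x i‖ ^ 2 : ℝ) : ℂ) := by
    intro i
    rw [← mul_assoc, ← Complex.ofReal_mul, Real.mul_self_sqrt (hc i)]
    push_cast
    rfl
  have h3 : ((‖∑ i, ((Real.sqrt (c i) : ℝ) : ℂ) • (x i ⊗ₜ[ℂ] f i)‖ ^ 2 : ℝ) : ℂ)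
      = ((∑ i, c i * ‖x i‖ ^ 2 : ℝ) : ℂ) := by
    rw [Complex.ofReal_sum, Complex.ofReal_pow]
    exact h.symm.trans (Finset.sum_congr rfl fun i _ => h2 i)
  exact_mod_cast h3

/-- Here `‖P v‖² = ∑ᵢ cᵢ ‖P eᵢ‖²`. Bessel's inequality for `u` puts the weights `‖P eᵢ‖²` in `[0,
1]`, and for `e` it bounds their sum by `k`; such an average is at most the sum of the `k` largest
`cᵢ`. -/
theorem HasSchmidtCoeffs.isKyFanBound {v : E ⊗[ℂ] F} {c : ℕ →₀ ℝ} (h : HasSchmidtCoeffs v c)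
    (k : ℕ) : IsKyFanBound k v (∑ i ∈ Finset.range k, c i) := by
  obtain ⟨hanti, h0, r, e, f, he, hf, -, rfl⟩ := h
  intro w hw
  obtain ⟨d, hd, u, hu, huw⟩ := hw.exists_projFamily
  refine (norm_inner_sq_le_of_fixed hu huw _).trans
    (mul_le_mul_of_nonneg_left ?_ (sq_nonneg _))
  simp only [map_sum, map_smul, TensorProduct.map_tmul, LinearMap.id_apply]
  rw [norm_sq_sum_smul_tmul hf (fun i => h0 i)]
  let t : ℕ → ℝ := fun i => if hi : i < r then ‖projFamily u (e ⟨i, hi⟩)‖ ^ 2 else 0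
  have ht : ∀ i : Fin r, t i = ‖projFamily u (e i)‖ ^ 2 := fun i => by simp [t]
  simp only [← ht]
  rw [← Finset.sum_range (fun i => c i * t i)]
  refine sum_mul_le_sum_range hanti h0 (fun i => ?_) (fun i => ?_) k r ?_
  · simp only [t]
    split_ifs <;> positivity
  · simp only [t]
    split_ifs with hi
    · rw [norm_projFamily_sq hu]
      refine (hu.sum_inner_products_le (e ⟨i, hi⟩)).trans ?_
      simp [he.1]
    · exact zero_le_one
  · rw [Finset.sum_range]
    simp only [ht, norm_projFamily_sq hu]
    rw [Finset.sum_comm]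
    calc ∑ j, ∑ i, ‖inner ℂ (u j) (e i)‖ ^ 2 ≤ ∑ j : Fin d, (1 : ℝ) := by
          refine Finset.sum_le_sum fun j _ => ?_
          simp only [norm_inner_symm (u j)]
          refine (he.sum_inner_products_le (u j)).trans ?_
          simp [hu.1]
      _ ≤ k := by simpa using hd

/-- The converse half: the Schmidt sum truncated after `k` terms is a test vector `w` with `⟨w, v⟩ =
‖w‖² =` the partial sum. -/
theorem HasSchmidtCoeffs.sum_range_le {v : E ⊗[ℂ] F} {c : ℕ →₀ ℝ} (h : HasSchmidtCoeffs v c)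
    {k : ℕ} {C : ℝ} (hC : 0 ≤ C) (hv : IsKyFanBound k v C) :
    ∑ i ∈ Finset.range k, c i ≤ C := by
  classical
  obtain ⟨hanti, h0, r, e, f, he, hf, hr, rfl⟩ := h
  let ι : Fin (min k r) → Fin r := Fin.castLE (min_le_right _ _)
  have hι : Function.Injective ι := Fin.castLE_injective _
  let w : E ⊗[ℂ] F := ∑ j, ((Real.sqrt (c (ι j)) : ℝ) : ℂ) • (e (ι j) ⊗ₜ[ℂ] f (ι j))
  have hw : ‖w‖ ^ 2 = ∑ j, c (ι j) := by
    simp only [w]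
    refine (norm_sq_sum_smul_tmul (hf.comp ι hι) (fun i => h0 _) _).trans ?_
    simp [he.1]
  have hwv : inner ℂ w (∑ i : Fin r, ((Real.sqrt (c i) : ℝ) : ℂ) • (e i ⊗ₜ[ℂ] f i))
      = ((∑ j, c (ι j) : ℝ) : ℂ) := by
    simp only [w]
    rw [sum_inner]
    simp only [inner_sum, inner_tensor_smul_left,
      inner_tensor_smul_right, TensorProduct.inner_tmul, orthonormal_iff_ite.mp hf, orthonormal_iff_ite.mp he, mul_ite,
      mul_one, mul_zero, Finset.sum_ite_eq, Finset.mem_univ, if_true, Complex.conj_ofReal]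
    rw [Complex.ofReal_sum]
    refine Finset.sum_congr rfl fun j _ => ?_
    rw [← Complex.ofReal_mul, Real.mul_self_sqrt (h0 _)]
  have hsum : ∑ j, c (ι j) = ∑ i ∈ Finset.range k, c i := by
    have : ∑ j, c (ι j) = ∑ i ∈ Finset.range (min k r), c i :=
      (Finset.sum_range (fun i => c i)).symm
    rw [this]
    refine Finset.sum_subset (by simp) fun i hi hi' => ?_
    by_contra hne
    have := Finset.mem_range.mp (hr (Finsupp.mem_support_iff.mpr hne))
    simp_all
  have hrank : TensorRankLE k w :=
    ⟨min k r, min_le_left _ _, fun j => ((Real.sqrt (c (ι j)) : ℝ) : ℂ) • e (ι j),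
      fun j => f (ι j), by simp [w, TensorProduct.smul_tmul']⟩
  have h1 := hv w hrank
  have hS : 0 ≤ ∑ j, c (ι j) := Finset.sum_nonneg fun j _ => h0 _
  rw [hwv, hw, Complex.norm_real, Real.norm_of_nonneg hS, sq] at h1
  rw [← hsum]
  rcases hS.eq_or_lt with h | h
  · exact h ▸ hC
  · exact le_of_mul_le_mul_left h1 h

theorem HasSchmidtCoeffs.norm_sq {v : E ⊗[ℂ] F} {c : ℕ →₀ ℝ} (h : HasSchmidtCoeffs v c) :
    ‖v‖ ^ 2 = c.sum fun _ t => t := by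
  obtain ⟨-, h0, r, e, f, he, hf, hr, rfl⟩ := h
  rw [norm_sq_sum_smul_tmul hf (fun i => h0 _), Finsupp.sum_of_support_subset _ hr _ (by simp),
    Finset.sum_range]
  simp [he.1]

end KyFan

/-! ### Necessity: block structure of measurements and induction on protocols. -/

section Necessity

variable {H : ℕ → Type*} [∀ n, NormedAddCommGroup (H n)] [∀ n, InnerProductSpace ℂ (H n)]

theorem CommutesWithNumber.map_single {M : LocalSpace H →L[ℂ] LocalSpace H}
    (hM : CommutesWithNumber M) (n : ℕ) (x : H n) :
    M (lp.single 2 n x) = lp.single 2 n (block M n x) := by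
  have h : NumberOperatorMaps (lp.single 2 n x : LocalSpace H)
      ((n : ℂ) • lp.single 2 n x) := by
    intro m
    rcases eq_or_ne m n with rfl | hmn
    · rfl
    · simp [Pi.single_eq_of_ne hmn]
  ext m
  rcases eq_or_ne m n with rfl | hmn
  · simp [block]
  -- The `m`-component `z` of the image satisfies `n • z = m • z`, hence vanishes.
  · have h1 := hM _ _ h m
    rw [map_smul, lp.coeFn_smul, Pi.smul_apply, ← sub_eq_zero, ← sub_smul, smul_eq_zero,
      sub_eq_zero] at h1
    rw [lp.single_apply_ne 2 n _ hmn]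
    exact h1.resolve_left (by exact_mod_cast hmn.symm)

theorem IsMeasurement.sum_inner_block [∀ n, CompleteSpace (H n)] {k : ℕ}
    {M : Fin k → LocalSpace H →L[ℂ] LocalSpace H} (hM : IsMeasurement M) (n : ℕ) (x y : H n) :
    ∑ i, inner ℂ (block (M i) n x) (block (M i) n y) = inner ℂ x y := by
  have h := congrArg (fun T : LocalSpace H →L[ℂ] LocalSpace H =>
    inner ℂ (lp.single 2 n x) (T (lp.single 2 n y))) hM.complete
  simpa [ContinuousLinearMap.adjoint_inner_right, inner_sum, (hM.commutes _).map_single,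
    lp.inner_single_left] using h

variable {HA : ℕ → Type*} [∀ n, NormedAddCommGroup (HA n)] [∀ n, InnerProductSpace ℂ (HA n)]
  {HB : ℕ → Type*} [∀ n, NormedAddCommGroup (HB n)] [∀ n, InnerProductSpace ℂ (HB n)]
  {N : ℕ} {ι : Type*}

theorem normSq_nonneg (ψ : Vec HA HB N) : 0 ≤ normSq ψ :=
  Finset.sum_nonneg fun _ _ => sq_nonneg _

theorem normSq_smul (c : ℂ) (ψ : Vec HA HB N) : normSq (c • ψ) = ‖c‖ ^ 2 * normSq ψ := by
  simp only [normSq, Finset.mul_sum]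
  refine Finset.sum_congr rfl fun n _ => ?_
  rw [Pi.smul_apply, norm_smul, mul_pow]

variable [∀ n, CompleteSpace (HA n)] [∀ n, CompleteSpace (HB n)]

theorem Protocol.prob_nonneg (π : Protocol HA HB ι) (ψ : Vec HA HB N) (α : ι) :
    0 ≤ π.prob ψ α := by
  induction π generalizing ψ with
  | halt β =>
    simp only [Protocol.prob]
    split_ifs
    exacts [normSq_nonneg ψ, le_rfl]
  | alice k M hM next ih => exact Finset.sum_nonneg fun i _ => ih i _
  | bob k M hM next ih => exact Finset.sum_nonneg fun i _ => ih i _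

/-- A leaf carrying `c • φ β` has bound `|c|² C β`, and `|c|²` is its probability as `φ β` is
normalised. At a measurement the bounds of the branches add up. -/
theorem Protocol.isKyFanBound [Fintype ι] {φ : ι → Vec HA HB N} (hφ : ∀ α, normSq (φ α) = 1)
    {n : Fin (N + 1)} {k : ℕ} {C : ι → ℝ} (hC : ∀ α, 0 ≤ C α)
    (hφC : ∀ α, IsKyFanBound k (φ α n) (C α)) (π : Protocol HA HB ι) (ψ : Vec HA HB N)
    (h : π.EndsIn φ ψ) : IsKyFanBound k (ψ n) (∑ α, π.prob ψ α * C α) := by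
  classical
  induction π generalizing ψ with
  | halt β =>
    obtain ⟨c, rfl⟩ := h
    simp only [Protocol.prob, ite_mul, zero_mul, Finset.sum_ite_eq, Finset.mem_univ, if_true,
      normSq_smul, hφ, mul_one]
    intro w hw
    have h1 : inner ℂ w ((c • φ β) n) = c * inner ℂ w (φ β n) := by
      rw [Pi.smul_apply, inner_tensor_smul_right]
    rw [h1, norm_mul, mul_pow, mul_left_comm]
    exact mul_le_mul_of_nonneg_left (hφC β w hw) (sq_nonneg _)
  | alice m M hM next ih =>
    simp only [Protocol.prob, Finset.sum_mul]
    rw [Finset.sum_comm]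
    have key : ∀ i, IsKyFanBound k (TensorProduct.map (block (M i) n) LinearMap.id (ψ n))
        (∑ α, (next i).prob (actA (M i) ψ) α * C α) := fun i => ih i (actA (M i) ψ) (h i)
    have h0 : ∀ i, 0 ≤ ∑ α, (next i).prob (actA (M i) ψ) α * C α :=
      fun i => Finset.sum_nonneg fun α _ => mul_nonneg (prob_nonneg _ _ _) (hC α)
    exact IsKyFanBound.of_left (hM.sum_inner_block n) h0 key
  | bob m M hM next ih =>
    simp only [Protocol.prob, Finset.sum_mul]
    rw [Finset.sum_comm]
    have key : ∀ i, IsKyFanBound k (TensorProduct.map LinearMap.id (block (M i) (N - n)) (ψ n))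
        (∑ α, (next i).prob (actB (M i) ψ) α * C α) := fun i => ih i (actB (M i) ψ) (h i)
    have h0 : ∀ i, 0 ≤ ∑ α, (next i).prob (actB (M i) ψ) α * C α :=
      fun i => Finset.sum_nonneg fun α _ => mul_nonneg (prob_nonneg _ _ _) (hC α)
    exact IsKyFanBound.of_right (hM.sum_inner_block (N - n)) h0 key

theorem majorized_of_convertible [Fintype ι] {ψ : Vec HA HB N} (hψ : normSq ψ = 1)
    {lam : Fin (N + 1) → ℕ →₀ ℝ} (hlam : ∀ n, HasSchmidtCoeffs (ψ n) (lam n))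
    {p : ι → ℝ} (hp1 : ∑ α, p α = 1)
    {φ : ι → Vec HA HB N} (hφ : ∀ α, normSq (φ α) = 1)
    {mu : ι → Fin (N + 1) → ℕ →₀ ℝ} (hmu : ∀ α n, HasSchmidtCoeffs (φ α n) (mu α n))
    (h : Convertible ψ p φ) (n : Fin (N + 1)) :
    Majorized (lam n) (∑ α, p α • mu α n) := by
  obtain ⟨π, hπ, hprob⟩ := h
  have key : ∀ n k, ∑ i ∈ Finset.range k, lam n i
      ≤ ∑ i ∈ Finset.range k, (∑ α, p α • mu α n) i := by
    intro n k
    have h0 : ∀ α, 0 ≤ ∑ i ∈ Finset.range k, mu α n i :=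
      fun α => Finset.sum_nonneg fun i _ => (hmu α n).2.1 i
    have h1 := Protocol.isKyFanBound hφ h0 (fun α => (hmu α n).isKyFanBound k) π ψ hπ
    have h2 := (hlam n).sum_range_le
      (Finset.sum_nonneg fun α _ => mul_nonneg (π.prob_nonneg ψ α) (h0 α)) h1
    simp only [hprob, Finset.mul_sum] at h2
    rw [Finset.sum_comm] at h2
    simpa [Finsupp.finsetSum_apply] using h2
  have htot : ∀ n, ∃ R, (lam n).sum (fun _ t => t) = ∑ i ∈ Finset.range R, lam n i ∧
      (∑ α, p α • mu α n).sum (fun _ t => t)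
        = ∑ i ∈ Finset.range R, (∑ α, p α • mu α n) i := by
    intro n
    obtain ⟨R, hR⟩ := ((lam n).support ∪ (∑ α, p α • mu α n).support).exists_nat_subset_range
    exact ⟨R, Finsupp.sum_of_support_subset _ (Finset.union_subset_left hR) _ (by simp),
      Finsupp.sum_of_support_subset _ (Finset.union_subset_right hR) _ (by simp)⟩
  have hle : ∀ n ∈ Finset.univ, (lam n).sum (fun _ t => t)
      ≤ (∑ α, p α • mu α n).sum fun _ t => t := by
    intro n _
    obtain ⟨R, h1, h2⟩ := htot n
    rw [h1, h2]
    exact key n R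
  have hsum : ∀ n, (∑ α, p α • mu α n).sum (fun _ t => t) = ∑ α, p α * ‖φ α n‖ ^ 2 := by
    intro n
    rw [← Finsupp.sum_finsetSum_index (by simp) (by simp)]
    refine Finset.sum_congr rfl fun α _ => ?_
    rw [(hmu α n).norm_sq, Finsupp.sum_smul_index (by simp), Finsupp.mul_sum]
  -- The sector totals are ordered termwise and both sum to 1 over all sectors, so they agree in
  -- each sector.
  refine ⟨key n, (Finset.sum_eq_sum_iff_of_le hle).mp ?_ n (Finset.mem_univ n)⟩
  simp only [hsum, ← (hlam _).norm_sq]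
  rw [Finset.sum_comm]
  simp only [← Finset.mul_sum]
  change normSq ψ = ∑ α, p α * normSq (φ α)
  simp [hψ, hφ, hp1]

end Necessity


/-! ### Majorization as a mixture of permutations, simultaneously in all sectors. -/

section Mixing

theorem sum_mul_le_sum_mul_of_partial_sums {R : ℕ} {w : Fin R → ℝ} (hw : Antitone w) {a b : ℕ → ℝ}
    (h : ∀ k, ∑ i ∈ Finset.range k, a i ≤ ∑ i ∈ Finset.range k, b i)
    (hR : ∑ i ∈ Finset.range R, a i = ∑ i ∈ Finset.range R, b i) :
    ∑ i, w i * a i ≤ ∑ i, w i * b i := by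
  let v : ℕ → ℝ := fun i => if hi : i < R then w ⟨i, hi⟩ else 0
  have hv : ∀ i : Fin R, v i = w i := fun i => by simp [v]
  -- Abel summation as an induction: lowering `v k` to `v (k + 1)` decreases the left side because
  -- the partial sums of `b - a` are nonnegative. The weights may be negative, hence the need for
  -- equal totals.
  have key : ∀ k < R, v k * ∑ i ∈ Finset.range (k + 1), (b i - a i)
      ≤ ∑ i ∈ Finset.range (k + 1), v i * (b i - a i) := by
    intro k
    induction k with
    | zero => simp
    | succ k ih =>
      intro hk
      have h1 := ih (by omega)
      have h2 : v (k + 1) ≤ v k := by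
        simpa only [v, hk, (show k < R by omega), dif_pos] using
          hw (show (⟨k, by omega⟩ : Fin R) ≤ ⟨k + 1, hk⟩ from Nat.le_succ k)
      have h3 : 0 ≤ ∑ i ∈ Finset.range (k + 1), (b i - a i) := by
        rw [Finset.sum_sub_distrib]
        exact sub_nonneg.mpr (h _)
      rw [Finset.sum_range_succ (n := k + 1), Finset.sum_range_succ (n := k + 1), mul_add]
      nlinarith [mul_le_mul_of_nonneg_right h2 h3]
  have h4 : 0 ≤ ∑ i ∈ Finset.range R, v i * (b i - a i) := by
    rcases R with - | R
    · simp
    · refine le_trans ?_ (key R (Nat.lt_succ_self R))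
      rw [Finset.sum_sub_distrib, hR]
      simp
  rw [Finset.sum_range] at h4
  simpa only [hv, mul_sub, Finset.sum_sub_distrib, sub_nonneg] using h4

/-- Otherwise a hyperplane separates `a` strictly from the hull of the tuples of permuted `b n`.
Sorting its coefficients `w n` in decreasing order contradicts this, by the rearrangement inequality
for `a n` and then Abel summation. Separating in the product over all `n` yields the common weights.
-/
theorem exists_permutation_mixture {m R : ℕ} {a b : Fin m → ℕ → ℝ} (ha : ∀ n, Antitone (a n))
    (h : ∀ n k, ∑ i ∈ Finset.range k, a n i ≤ ∑ i ∈ Finset.range k, b n i)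
    (hR : ∀ n, ∑ i ∈ Finset.range R, a n i = ∑ i ∈ Finset.range R, b n i) :
    ∃ (κ : Type) (_ : Fintype κ) (q : κ → ℝ) (σ : κ → Fin m → Equiv.Perm (Fin R)),
      (∀ s, 0 ≤ q s) ∧ ∑ s, q s = 1 ∧
        ∀ n (i : Fin R), a n i = ∑ s, q s * b n (σ s n i) := by
  classical
  let B : (Fin m → Equiv.Perm (Fin R)) → Fin m → Fin R → ℝ := fun σ n i => b n (σ n i)
  let x : Fin m → Fin R → ℝ := fun n i => a n i
  have hx : x ∈ convexHull ℝ (Set.range B) := by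
    by_contra hx
    obtain ⟨g, u, hgu, hux⟩ := geometric_hahn_banach_closed_point
      (convex_convexHull ℝ (Set.range B)) ((Set.finite_range B).isClosed_convexHull ℝ) hx
    let w : Fin m → Fin R → ℝ := fun n i => g (Pi.single n (Pi.single i 1))
    have hg : ∀ z : Fin m → Fin R → ℝ, g z = ∑ n, ∑ i, w n i * z n i := by
      intro z
      have hz : z = ∑ n, ∑ i, z n i • (Pi.single n (Pi.single i 1) : Fin m → Fin R → ℝ) := by
        ext n i
        simp [Finset.sum_apply, Pi.single_apply, ite_apply]
      conv_lhs => rw [hz]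
      simp only [map_sum, map_smul, smul_eq_mul, w, mul_comm]
    let τ : Fin m → Equiv.Perm (Fin R) := fun n => Tuple.sort fun i => -w n i
    have hτ : ∀ n, Antitone (w n ∘ τ n) := fun n i j hij =>
      neg_le_neg_iff.mp (Tuple.monotone_sort (fun i => -w n i) hij)
    have hle : g x ≤ g (B fun n => (τ n).symm) := by
      rw [hg, hg]
      refine Finset.sum_le_sum fun n _ => ?_
      have hx' : Antitone (x n) := fun i j hij => ha n hij
      calc ∑ i, w n i * x n i = ∑ i, (w n ∘ τ n) ((τ n).symm i) * x n i := by simp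
        _ ≤ ∑ i, (w n ∘ τ n) i * x n i := ((hτ n).monovary hx').sum_comp_perm_mul_le_sum_mul
        _ ≤ ∑ i : Fin R, (w n ∘ τ n) i * b n i :=
          sum_mul_le_sum_mul_of_partial_sums (hτ n) (h n) (hR n)
        _ = ∑ i, w n i * B (fun n => (τ n).symm) n i := by
          rw [← Equiv.sum_comp (τ n).symm]
          simp [B]
    exact absurd (hgu _ (subset_convexHull ℝ _ ⟨_, rfl⟩)) (not_lt.mpr (hux.le.trans hle))
  obtain ⟨κ, hκ, q, z, hq, hq1, hz, hsum⟩ := mem_convexHull_iff_exists_fintype.mp hx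
  choose σ hσ using hz
  refine ⟨κ, hκ, q, σ, hq, hq1, fun n i => ?_⟩
  have := congrFun (congrFun hsum n) i
  simp only [← hσ, Finset.sum_apply, Pi.smul_apply, smul_eq_mul] at this
  exact this.symm

end Mixing

/-! ### Kraus operators built from orthogonal families. -/

section Families

variable {K J : Type*} [NormedAddCommGroup K] [InnerProductSpace ℂ K] [Fintype J]

/-- A family of pairwise orthogonal vectors, a unit vector where `c` does not vanish and zero
where it does. -/
def IsUnitOn {J : Type*} (c : J → ℝ) (x : J → K) : Prop :=
  (∀ i j, i ≠ j → inner ℂ (x i) (x j) = 0) ∧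
    ∀ i, (c i ≠ 0 → inner ℂ (x i) (x i) = 1) ∧ (c i = 0 → x i = 0)

/-- The operator `∑ⱼ cⱼ |yⱼ⟩⟨xⱼ|`. -/
noncomputable def familyOp (c : J → ℝ) (y x : J → K) : K →L[ℂ] K :=
  ∑ j, (c j : ℂ) • InnerProductSpace.rankOne ℂ (y j) (x j)

theorem familyOp_apply (c : J → ℝ) (y x : J → K) (z : K) :
    familyOp c y x z = ∑ j, ((c j : ℂ) * inner ℂ (x j) z) • y j := by
  simp [familyOp, mul_smul]

theorem inner_familyOp {c d : J → ℝ} {y : J → K} (hy : IsUnitOn d y)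
    (hc : ∀ j, d j = 0 → c j = 0) (x : J → K) (u v : K) :
    inner ℂ (familyOp c y x u) (familyOp c y x v)
      = ∑ j, ((c j ^ 2 : ℝ) : ℂ) * (inner ℂ u (x j) * inner ℂ (x j) v) := by
  rw [familyOp_apply, familyOp_apply, sum_inner]
  refine Finset.sum_congr rfl fun j _ => ?_
  rw [inner_sum, Finset.sum_eq_single j]
  · rw [inner_smul_left, inner_smul_right, map_mul, inner_conj_symm, Complex.conj_ofReal]
    by_cases h : d j = 0
    · simp [hc j h]
    · rw [(hy.2 j).1 h]
      push_cast
      ring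
  · intro i _ hij
    rw [inner_smul_left, inner_smul_right, hy.1 j i hij.symm, mul_zero, mul_zero]
  · simp

theorem IsUnitOn.inner_proj_compl {d : J → ℝ} {x : J → K} (hx : IsUnitOn d x) (u v : K) :
    inner ℂ (u - familyOp 1 x x u) (v - familyOp 1 x x v)
      = inner ℂ u v - ∑ j, inner ℂ u (x j) * inner ℂ (x j) v := by
  classical
  -- The constant coefficient 1 does not vanish where `x j = 0`, as `inner_familyOp` requires; the
  -- indicator does and defines the same operator.
  let c : J → ℝ := fun j => if d j = 0 then 0 else 1
  have hc : familyOp 1 x x = familyOp c x x := by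
    refine Finset.sum_congr rfl fun j _ => ?_
    by_cases h : d j = 0
    · simp [(hx.2 j).2 h]
    · simp [c, h]
  have h1 : inner ℂ (familyOp 1 x x u) (familyOp 1 x x v)
      = ∑ j, inner ℂ u (x j) * inner ℂ (x j) v := by
    rw [hc, inner_familyOp hx (fun j h => by simp [c, h])]
    refine Finset.sum_congr rfl fun j _ => ?_
    by_cases h : d j = 0
    · simp [(hx.2 j).2 h]
    · simp [c, h]
  rw [inner_sub_left, inner_sub_right, inner_sub_right, h1]
  simp [familyOp_apply, inner_sum, sum_inner, inner_smul_left, inner_smul_right, mul_comm]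

/-- The Kraus operators `∑ⱼ c s j |y s j⟩⟨xⱼ|`, completed by the projection on the orthogonal
complement of the vectors `xⱼ`. -/
noncomputable def completedKraus {κ : Type*} (c : κ → J → ℝ) (y : κ → J → K) (x : J → K) :
    Option κ → K →L[ℂ] K
  | none => ContinuousLinearMap.id ℂ K - familyOp 1 x x
  | some s => familyOp (c s) (y s) x

/-- The outcomes `some s` add up to the projection on the span of the `x j`, and `none` supplies the
complement. In the protocols the state lies in that span, so `none` has probability zero. -/
theorem sum_inner_completedKraus {κ : Type*} [Fintype κ] {c d : κ → J → ℝ} {y : κ → J → K}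
    {x : J → K} {b : J → ℝ} (hx : IsUnitOn b x) (hy : ∀ s, IsUnitOn (d s) (y s))
    (hcd : ∀ s j, d s j = 0 → c s j = 0) (hc : ∀ j, b j ≠ 0 → ∑ s, c s j ^ 2 = 1) (u v : K) :
    ∑ s, inner ℂ (completedKraus c y x s u) (completedKraus c y x s v) = inner ℂ u v := by
  rw [Fintype.sum_option]
  simp only [completedKraus, sub_apply, ContinuousLinearMap.id_apply]
  rw [hx.inner_proj_compl]
  simp only [inner_familyOp (hy _) (hcd _)]
  rw [Finset.sum_comm]
  simp only [← Finset.sum_mul, ← Complex.ofReal_sum]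
  rw [sub_add_eq_add_sub, sub_eq_iff_eq_add]
  congr 1
  refine Finset.sum_congr rfl fun j _ => ?_
  by_cases h : b j = 0
  · simp [(hx.2 j).2 h]
  · simp [hc j h]

/-- Padding by zero vectors gives all states one index set, even when the space is too small for
more orthonormal vectors. -/
theorem _root_.Orthonormal.isUnitOn_extend {r : ℕ} {g : Fin r → K} (hg : Orthonormal ℂ g)
    {c : ℕ → ℝ} (hc : ∀ i, c i ≠ 0 → i < r) :
    IsUnitOn c (fun i => if hi : c i ≠ 0 then g ⟨i, hc i hi⟩ else 0) := by
  refine ⟨fun i j hij => ?_, fun i => ⟨fun hi => ?_, fun hi => ?_⟩⟩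
  · by_cases hi : c i = 0
    · simp [hi]
    by_cases hj : c j = 0
    · simp [hj]
    simp only [ne_eq, hi, hj, not_false_iff, dif_pos]
    exact hg.2 (by simpa using hij)
  · simp only [hi, ne_eq, not_false_iff, dif_pos]
    rw [inner_self_eq_norm_sq_to_K, hg.1]
    simp
  · simp [hi]

theorem HasSchmidtCoeffs.exists_isUnitOn {E F : Type*} [NormedAddCommGroup E]
    [InnerProductSpace ℂ E] [NormedAddCommGroup F] [InnerProductSpace ℂ F] {v : E ⊗[ℂ] F}
    {c : ℕ →₀ ℝ} (h : HasSchmidtCoeffs v c) :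
    ∃ (e : ℕ → E) (f : ℕ → F), IsUnitOn c e ∧ IsUnitOn c f ∧ ∀ R, c.support ⊆ Finset.range R →
      v = ∑ i : Fin R, ((Real.sqrt (c i) : ℝ) : ℂ) • (e i ⊗ₜ[ℂ] f i) := by
  obtain ⟨-, h0, r, e, f, he, hf, hr, rfl⟩ := h
  have hlt : ∀ i, c i ≠ 0 → i < r := fun i hi =>
    Finset.mem_range.mp (hr (Finsupp.mem_support_iff.mpr hi))
  refine ⟨_, _, he.isUnitOn_extend hlt, hf.isUnitOn_extend hlt, fun R hR => ?_⟩
  let t : ℕ → E ⊗[ℂ] F := fun i => ((Real.sqrt (c i) : ℝ) : ℂ) •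
    ((if hi : c i ≠ 0 then e ⟨i, hlt i hi⟩ else 0)
      ⊗ₜ[ℂ] (if hi : c i ≠ 0 then f ⟨i, hlt i hi⟩ else 0))
  have ht : ∀ i : Fin r, t i = ((Real.sqrt (c i) : ℝ) : ℂ) • (e i ⊗ₜ[ℂ] f i) := by
    intro i
    by_cases hi : c i = 0
    · simp only [t, hi, Real.sqrt_zero, Complex.ofReal_zero, zero_smul]
    · simp [t, hi]
  have hsupp : ∀ {m}, c.support ⊆ Finset.range m →
      ∑ i : Fin m, t i = ∑ i ∈ c.support, t i := by
    intro m hm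
    rw [← Finset.sum_range]
    refine (Finset.sum_subset hm fun i _ hi => ?_).symm
    simp only [t, Finsupp.notMem_support_iff.mp hi, Real.sqrt_zero, Complex.ofReal_zero, zero_smul]
  simp only [← ht]
  rw [hsupp hr]
  exact (hsupp hR).symm

end Families

/-! ### Assembling families from the sectors into number-preserving operators. -/

section Sectors

variable {H : ℕ → Type*} [∀ n, NormedAddCommGroup (H n)] [∀ n, InnerProductSpace ℂ (H n)]
  {m R : ℕ} {deg : Fin m → ℕ}

/-- The vectors `x n i`, which have particle number `deg n`, as vectors of the local space. -/
noncomputable def sectorFamily (deg : Fin m → ℕ) (x : ∀ n, Fin R → H (deg n)) :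
    Fin m × Fin R → LocalSpace H :=
  fun j => lp.single 2 (deg j.1) (x j.1 j.2)

theorem IsUnitOn.comp {K J J' : Type*} [NormedAddCommGroup K] [InnerProductSpace ℂ K]
    {c : J → ℝ} {x : J → K} (h : IsUnitOn c x) {g : J' → J} (hg : Function.Injective g) :
    IsUnitOn (fun j => c (g j)) (fun j => x (g j)) :=
  ⟨fun _ _ hij => h.1 _ _ (hg.ne hij), fun _ => h.2 _⟩

theorem isUnitOn_sectorFamily (hdeg : Function.Injective deg) {c : Fin m → Fin R → ℝ}
    {x : ∀ n, Fin R → H (deg n)} (h : ∀ n, IsUnitOn (c n) (x n)) :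
    IsUnitOn (fun j : Fin m × Fin R => c j.1 j.2) (sectorFamily deg x) := by
  refine ⟨?_, ?_⟩
  · rintro ⟨n, i⟩ ⟨n', i'⟩ hne
    simp only [sectorFamily]
    rw [lp.inner_single_left]
    rcases eq_or_ne n n' with rfl | hn
    · rw [lp.single_apply_self]
      exact (h n).1 i i' fun hi => hne (by rw [hi])
    · rw [lp.single_apply_ne _ _ _ (hdeg.ne hn), inner_zero_right]
  · rintro ⟨n, i⟩
    refine ⟨fun hc => ?_, fun hc => ?_⟩
    · simp only [sectorFamily]
      rw [lp.inner_single_left, lp.single_apply_self]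
      exact ((h n).2 i).1 hc
    · simp only [sectorFamily, ((h n).2 i).2 hc]
      exact map_zero (lp.singleAddMonoidHom 2 (deg n))

theorem commutesWithNumber_familyOp (c : Fin m × Fin R → ℝ) (y x : ∀ n, Fin R → H (deg n)) :
    CommutesWithNumber (familyOp c (sectorFamily deg y) (sectorFamily deg x)) := by
  intro u v huv k
  simp only [familyOp_apply, sectorFamily, lp.inner_single_left, lp.coeFn_sum, Finset.sum_apply,
    lp.coeFn_smul, Pi.smul_apply, Finset.smul_sum]
  refine Finset.sum_congr rfl fun j _ => ?_
  rcases eq_or_ne k (deg j.1) with rfl | hk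
  · rw [huv, inner_smul_right, smul_smul]
    congr 1
    ring
  · rw [lp.single_apply_ne _ _ _ hk, smul_zero, smul_zero, smul_zero]

theorem commutesWithNumber_completedKraus {κ : Type*} (c : κ → Fin m × Fin R → ℝ)
    (y : κ → ∀ n, Fin R → H (deg n)) (x : ∀ n, Fin R → H (deg n)) (s : Option κ) :
    CommutesWithNumber
      (completedKraus c (fun s => sectorFamily deg (y s)) (sectorFamily deg x) s) := by
  cases s with
  | none =>
    intro u v huv k
    simp only [completedKraus, sub_apply, ContinuousLinearMap.id_apply, lp.coeFn_sub,
      Pi.sub_apply, smul_sub]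
    rw [huv k, commutesWithNumber_familyOp 1 x x u v huv k]
  | some s => exact commutesWithNumber_familyOp (c s) (y s) x

theorem block_familyOp (hdeg : Function.Injective deg) (c : Fin m × Fin R → ℝ)
    (y x : ∀ n, Fin R → H (deg n)) (n : Fin m) (z : H (deg n)) :
    block (familyOp c (sectorFamily deg y) (sectorFamily deg x)) (deg n) z
      = ∑ i, ((c (n, i) : ℂ) * inner ℂ (x n i) z) • y n i := by
  simp only [block, LinearMap.coe_mk, AddHom.coe_mk, familyOp_apply, sectorFamily,
    lp.inner_single_left, lp.coeFn_sum, Finset.sum_apply, lp.coeFn_smul, Pi.smul_apply]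
  rw [Fintype.sum_prod_type, Finset.sum_eq_single n]
  · simp only [lp.single_apply_self]
  · intro n' _ hn
    refine Finset.sum_eq_zero fun i _ => ?_
    rw [lp.single_apply_ne _ _ _ (hdeg.ne hn.symm), smul_zero]
  · simp

theorem block_familyOp_apply (hdeg : Function.Injective deg) (c : Fin m × Fin R → ℝ)
    (y x : ∀ n, Fin R → H (deg n)) {n : Fin m} {b : Fin R → ℝ} (hx : IsUnitOn b (x n))
    {i : Fin R} (hi : b i ≠ 0) :
    block (familyOp c (sectorFamily deg y) (sectorFamily deg x)) (deg n) (x n i)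
      = (c (n, i) : ℂ) • y n i := by
  rw [block_familyOp hdeg, Finset.sum_eq_single i]
  · rw [(hx.2 i).1 hi, mul_one]
  · intro j _ hj
    rw [hx.1 j i hj, mul_zero, zero_smul]
  · simp

theorem block_completedKraus_none (hdeg : Function.Injective deg) {κ : Type*}
    (c : κ → Fin m × Fin R → ℝ) (y : κ → ∀ n, Fin R → H (deg n)) (x : ∀ n, Fin R → H (deg n))
    {n : Fin m} {b : Fin R → ℝ} (hx : IsUnitOn b (x n)) {i : Fin R} (hi : b i ≠ 0) :
    block (completedKraus c (fun s => sectorFamily deg (y s)) (sectorFamily deg x) none) (deg n)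
      (x n i) = 0 := by
  have h := block_familyOp_apply hdeg 1 x x hx hi
  simp only [Pi.one_apply, Complex.ofReal_one, one_smul] at h
  simp only [block, LinearMap.coe_mk, AddHom.coe_mk] at h ⊢
  simp only [completedKraus, sub_apply, ContinuousLinearMap.id_apply, lp.coeFn_sub, Pi.sub_apply,
    lp.single_apply_self]
  rw [h, sub_self]

theorem isMeasurement_of_sum_inner [∀ n, CompleteSpace (H n)] {κ : Type*} [Fintype κ]
    {M : κ → LocalSpace H →L[ℂ] LocalSpace H}
    (hM : ∀ u v, ∑ s, inner ℂ (M s u) (M s v) = inner ℂ u v)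
    (hcomm : ∀ s, CommutesWithNumber (M s)) :
    IsMeasurement fun i => M ((Fintype.equivFin κ).symm i) := by
  refine ⟨?_, fun i => hcomm _⟩
  refine ContinuousLinearMap.ext fun v => ext_inner_left ℂ fun u => ?_
  rw [Equiv.sum_comp (Fintype.equivFin κ).symm
    fun s => (ContinuousLinearMap.adjoint (M s)) ∘L (M s)]
  simpa [ContinuousLinearMap.adjoint_inner_right, inner_sum] using hM u v

end Sectors

/-! ### Sufficiency: composing protocols and Bob's final rotation. -/

section Sufficiency

variable {HA : ℕ → Type*} [∀ n, NormedAddCommGroup (HA n)] [∀ n, InnerProductSpace ℂ (HA n)]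
  [∀ n, CompleteSpace (HA n)]
  {HB : ℕ → Type*} [∀ n, NormedAddCommGroup (HB n)] [∀ n, InnerProductSpace ℂ (HB n)]
  [∀ n, CompleteSpace (HB n)]
  {N : ℕ} {ι : Type*} {φ : ι → Vec HA HB N}

theorem convertible_smul [DecidableEq ι] (c : ℂ) (β : ι) :
    Convertible (c • φ β) (fun α => if β = α then normSq (c • φ β) else 0) φ := by
  refine ⟨.halt β, ⟨c, rfl⟩, fun α => ?_⟩
  simp only [Protocol.prob]
  congr

/-- Disposes of the `none` branches: the zero vector is a multiple of any target, so any label may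
be announced. -/
theorem convertible_zero [Nonempty ι] : Convertible (0 : Vec HA HB N) (fun _ => 0) φ := by
  classical
  obtain ⟨β⟩ := ‹Nonempty ι›
  have h := convertible_smul (φ := φ) 0 β
  simpa [normSq] using h

theorem Convertible.of_alice {κ : Type*} [Fintype κ]
    {M : κ → LocalSpace HA →L[ℂ] LocalSpace HA}
    (hM : ∀ u v, ∑ s, inner ℂ (M s u) (M s v) = inner ℂ u v)
    (hcomm : ∀ s, CommutesWithNumber (M s)) {ψ : Vec HA HB N} {g : κ → ι → ℝ}
    (h : ∀ s, Convertible (actA (M s) ψ) (g s) φ) :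
    Convertible ψ (fun α => ∑ s, g s α) φ := by
  choose π hπ hg using h
  refine ⟨.alice _ _ (isMeasurement_of_sum_inner hM hcomm)
    fun i => π ((Fintype.equivFin κ).symm i), fun i => hπ _, fun α => ?_⟩
  simp only [Protocol.prob, hg]
  exact Equiv.sum_comp (Fintype.equivFin κ).symm fun s => g s α

theorem Convertible.of_bob {κ : Type*} [Fintype κ]
    {M : κ → LocalSpace HB →L[ℂ] LocalSpace HB}
    (hM : ∀ u v, ∑ s, inner ℂ (M s u) (M s v) = inner ℂ u v)
    (hcomm : ∀ s, CommutesWithNumber (M s)) {ψ : Vec HA HB N} {g : κ → ι → ℝ}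
    (h : ∀ s, Convertible (actB (M s) ψ) (g s) φ) :
    Convertible ψ (fun α => ∑ s, g s α) φ := by
  choose π hπ hg using h
  refine ⟨.bob _ _ (isMeasurement_of_sum_inner hM hcomm)
    fun i => π ((Fintype.equivFin κ).symm i), fun i => hπ _, fun α => ?_⟩
  simp only [Protocol.prob, hg]
  exact Equiv.sum_comp (Fintype.equivFin κ).symm fun s => g s α

/-- If Alice's half of the Schmidt decomposition of `φ β` is in place, Bob can rotate his half. -/
theorem convertible_of_bob_rotation [Nonempty ι] [DecidableEq ι] {β : ι} {R : ℕ} {t : ℝ}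
    (ht : 0 ≤ t) {μ : Fin (N + 1) → Fin R → ℝ}
    (hφ : normSq (φ β) = 1)
    {e : ∀ n : Fin (N + 1), Fin R → HA n} {f g : ∀ n : Fin (N + 1), Fin R → HB (N - n)}
    {b : Fin (N + 1) → Fin R → ℝ} (hf : ∀ n, IsUnitOn (b n) (f n))
    (hb : ∀ n i, b n i = 0 → t * μ n i = 0) (hg : ∀ n, IsUnitOn (μ n) (g n))
    (hφβ : ∀ n, φ β n = ∑ i, ((Real.sqrt (μ n i) : ℝ) : ℂ) • (e n i ⊗ₜ[ℂ] g n i))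
    {χ : Vec HA HB N}
    (hχ : ∀ n, χ n = ∑ i, ((Real.sqrt (t * μ n i) : ℝ) : ℂ) • (e n i ⊗ₜ[ℂ] f n i)) :
    Convertible χ (fun α => if β = α then t else 0) φ := by
  classical
  let deg : Fin (N + 1) → ℕ := fun n => N - n
  have hdeg : Function.Injective deg := by
    intro n n' h
    have : N - (n : ℕ) = N - n' := h
    ext
    omega
  -- Some `f n i` may be absent from `χ`, and their targets `g n i` may be zero. Dropping them
  -- leaves an isometry on the span of the rest.
  let x : ∀ n : Fin (N + 1), Fin R → HB (deg n) := fun n i => if t * μ n i = 0 then 0 else f n i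
  have hx : ∀ n, IsUnitOn (fun i => t * μ n i) (x n) := by
    intro n
    refine ⟨fun i j hij => ?_, fun i => ⟨fun hi => ?_, fun hi => ?_⟩⟩
    · simp only [x]
      split_ifs
      · simp
      · simp
      · simp
      · exact (hf n).1 i j hij
    · simp only [x, hi, if_false]
      exact ((hf n).2 i).1 fun h => hi (hb n i h)
    · simp only [x, hi, if_true]
  let c : Unit → Fin (N + 1) × Fin R → ℝ := fun _ j => if μ j.1 j.2 = 0 then 0 else 1
  have hM := sum_inner_completedKraus (c := c) (isUnitOn_sectorFamily hdeg hx)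
    (y := fun _ => sectorFamily deg g) (fun _ => isUnitOn_sectorFamily hdeg hg)
    (fun _ j hj => by simp only [c]; exact if_pos hj)
    (fun j hj => by
      have : μ j.1 j.2 ≠ 0 := right_ne_zero_of_mul hj
      simp [c, this])
  have hχ' : ∀ n, χ n = ∑ i, ((Real.sqrt (t * μ n i) : ℝ) : ℂ) • (e n i ⊗ₜ[ℂ] x n i) := by
    intro n
    rw [hχ]
    refine Finset.sum_congr rfl fun i _ => ?_
    by_cases hi : t * μ n i = 0
    · simp only [hi, Real.sqrt_zero, Complex.ofReal_zero, zero_smul]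
    · simp only [x, hi, if_false]
  have hbr := Convertible.of_bob (φ := φ) (ψ := χ) hM
    (commutesWithNumber_completedKraus c (fun _ => g) x)
    (g := fun s α => match s with
      | none => 0
      | some _ => if β = α then t else 0) ?_
  · simpa [Fintype.sum_option] using hbr
  · rintro (- | s)
    · have h0 : actB (completedKraus c (fun _ => sectorFamily deg g) (sectorFamily deg x) none) χ
          = 0 := by
        funext n
        simp only [actB]
        rw [hχ' n]
        simp only [map_sum, map_smul, TensorProduct.map_tmul, LinearMap.id_apply]
        refine Finset.sum_eq_zero fun i _ => ?_
        by_cases hi : t * μ n i = 0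
        · simp only [hi, Real.sqrt_zero, Complex.ofReal_zero, zero_smul]
        · have := block_completedKraus_none hdeg c (fun _ => g) x (hx n) hi
          simp only [deg] at this
          rw [this, TensorProduct.tmul_zero, smul_zero]
      rw [h0]
      exact convertible_zero
    · have h1 : actB (completedKraus c (fun _ => sectorFamily deg g) (sectorFamily deg x)
          (some s)) χ = ((Real.sqrt t : ℝ) : ℂ) • φ β := by
        funext n
        simp only [actB, Pi.smul_apply]
        rw [hχ' n, hφβ n, Finset.smul_sum]
        simp only [map_sum, map_smul, TensorProduct.map_tmul, LinearMap.id_apply]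
        refine Finset.sum_congr rfl fun i _ => ?_
        rw [smul_smul, ← Complex.ofReal_mul, ← Real.sqrt_mul ht]
        by_cases hi : t * μ n i = 0
        · simp only [hi, Real.sqrt_zero, Complex.ofReal_zero, zero_smul]
        · have := block_familyOp_apply hdeg (c s) g x (hx n) hi
          have hc : c s (n, i) = 1 := if_neg (right_ne_zero_of_mul hi)
          rw [hc, Complex.ofReal_one, one_smul] at this
          exact congrArg (fun z => ((Real.sqrt (t * μ n i) : ℝ) : ℂ) • (e n i ⊗ₜ[ℂ] z)) this
      rw [h1]
      have h2 := convertible_smul (φ := φ) ((Real.sqrt t : ℝ) : ℂ) β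
      have h3 : normSq (((Real.sqrt t : ℝ) : ℂ) • φ β) = t := by
        rw [normSq_smul, hφ, mul_one, Complex.norm_real, Real.norm_of_nonneg (Real.sqrt_nonneg _),
          Real.sq_sqrt ht]
      rwa [h3] at h2

end Sufficiency

/-! ### Sufficiency: Alice's measurement from the permutation mixture. -/

section Sufficiency

variable {HA : ℕ → Type*} [∀ n, NormedAddCommGroup (HA n)] [∀ n, InnerProductSpace ℂ (HA n)]
  [∀ n, CompleteSpace (HA n)]
  {HB : ℕ → Type*} [∀ n, NormedAddCommGroup (HB n)] [∀ n, InnerProductSpace ℂ (HB n)]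
  [∀ n, CompleteSpace (HB n)]
  {N : ℕ} {ι : Type*}

theorem exists_permutation_ensemble [Fintype ι] {m : ℕ} {lam : Fin m → ℕ →₀ ℝ}
    {p : ι → ℝ} {mu : ι → Fin m → ℕ →₀ ℝ} (hlam : ∀ n, Antitone (lam n))
    (h : ∀ n, Majorized (lam n) (∑ α, p α • mu α n)) :
    ∃ R : ℕ, (∀ n, (lam n).support ⊆ Finset.range R) ∧
      (∀ α n, (mu α n).support ⊆ Finset.range R) ∧
      ∃ (κ : Type) (_ : Fintype κ) (q : κ → ℝ) (σ : κ → Fin m → Equiv.Perm (Fin R)),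
        (∀ s, 0 ≤ q s) ∧ ∑ s, q s = 1 ∧
          ∀ n (i : Fin R), lam n i = ∑ s, q s * ∑ α, p α * mu α n (σ s n i) := by
  classical
  obtain ⟨R, hR⟩ := ((Finset.univ.biUnion fun n => (lam n).support) ∪
    (Finset.univ.biUnion fun n => Finset.univ.biUnion fun α =>
      (mu α n).support)).exists_nat_subset_range
  have hR1 : ∀ n, (lam n).support ⊆ Finset.range R := fun n i hi => hR <| by
    simp only [Finset.mem_union, Finset.mem_biUnion, Finset.mem_univ, true_and]
    exact Or.inl ⟨n, hi⟩
  have hR2 : ∀ α n, (mu α n).support ⊆ Finset.range R := fun α n i hi => hR <| by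
    simp only [Finset.mem_union, Finset.mem_biUnion, Finset.mem_univ, true_and]
    exact Or.inr ⟨n, α, hi⟩
  have happ : ∀ n i, (∑ α, p α • mu α n) i = ∑ α, p α * mu α n i := by
    intro n i
    simp [Finsupp.finsetSum_apply]
  have hR3 : ∀ n, (∑ α, p α • mu α n).support ⊆ Finset.range R := by
    intro n i hi
    by_contra hne
    refine Finsupp.mem_support_iff.mp hi ?_
    rw [happ]
    refine Finset.sum_eq_zero fun α _ => ?_
    rw [Finsupp.notMem_support_iff.mp fun h' => hne (hR2 α n h'), mul_zero]
  obtain ⟨κ, hκ, q, σ, hq, hq1, hmix⟩ := exists_permutation_mixture (R := R)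
    (b := fun n i => (∑ α, p α • mu α n) i) hlam (fun n => (h n).1) (fun n => by
      have := (h n).2
      rwa [Finsupp.sum_of_support_subset _ (hR1 n) _ (by simp),
        Finsupp.sum_of_support_subset _ (hR3 n) _ (by simp)] at this)
  refine ⟨R, hR1, hR2, κ, hκ, q, σ, hq, hq1, fun n i => ?_⟩
  simpa only [happ] using hmix n i

theorem convertible_of_majorized [Fintype ι] {ψ : Vec HA HB N}
    {lam : Fin (N + 1) → ℕ →₀ ℝ} (hlam : ∀ n, HasSchmidtCoeffs (ψ n) (lam n))
    {p : ι → ℝ} (hp : ∀ α, 0 ≤ p α) (hp1 : ∑ α, p α = 1)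
    {φ : ι → Vec HA HB N} (hφ : ∀ α, normSq (φ α) = 1)
    {mu : ι → Fin (N + 1) → ℕ →₀ ℝ} (hmu : ∀ α n, HasSchmidtCoeffs (φ α n) (mu α n))
    (h : ∀ n, Majorized (lam n) (∑ α, p α • mu α n)) : Convertible ψ p φ := by
  classical
  have hι : Nonempty ι := by
    by_contra hne
    rw [not_nonempty_iff] at hne
    simp at hp1
  obtain ⟨R, hR1, hR2, κ, hκ, q, σ, hq, hq1, hmix⟩ :=
    exists_permutation_ensemble (fun n => (hlam n).1) h
  choose e f he hf hψ using fun n => (hlam n).exists_isUnitOn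
  choose e' f' he' hf' hφ' using fun α n => (hmu α n).exists_isUnitOn
  have hmu0 : ∀ α n i, 0 ≤ mu α n i := fun α n => (hmu α n).2.1
  let t : κ × ι → ℝ := fun s => q s.1 * p s.2
  have ht : ∀ s, 0 ≤ t s := fun s => mul_nonneg (hq _) (hp _)
  let μ : κ × ι → Fin (N + 1) → Fin R → ℝ := fun s n i => mu s.2 n (σ s.1 n i)
  have hμ : ∀ s n i, 0 ≤ t s * μ s n i := fun s n i => mul_nonneg (ht s) (hmu0 _ _ _)
  have hsum : ∀ n (i : Fin R), lam n i = ∑ s, t s * μ s n i := by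
    intro n i
    rw [hmix, Fintype.sum_prod_type]
    simp only [t, μ, Finset.mul_sum, mul_assoc]
  -- A vanishing `lam n i` is a sum of nonnegative terms, so an index missing from `ψ` carries no
  -- weight in any outcome.
  have hzero : ∀ s n (i : Fin R), lam n i = 0 → t s * μ s n i = 0 := by
    intro s n i h0
    rw [hsum] at h0
    exact (Finset.sum_eq_zero_iff_of_nonneg fun s _ => hμ s n i).mp h0 s (Finset.mem_univ s)
  let deg : Fin (N + 1) → ℕ := fun n => n
  have hdeg : Function.Injective deg := Fin.val_injective
  let x : ∀ n : Fin (N + 1), Fin R → HA (deg n) := fun n i => e n i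
  let y : κ × ι → ∀ n : Fin (N + 1), Fin R → HA (deg n) := fun s n i => e' s.2 n (σ s.1 n i)
  have hx : ∀ n, IsUnitOn (fun i : Fin R => lam n i) (x n) :=
    fun n => (he n).comp Fin.val_injective
  have hy : ∀ s n, IsUnitOn (μ s n) (y s n) :=
    fun s n => (he' s.2 n).comp (Fin.val_injective.comp (σ s.1 n).injective)
  -- Chosen so that `√λ · c = √(t μ)`; by `hsum` the squares add up to 1 over the outcomes wherever
  -- `λ ≠ 0`.
  let c : κ × ι → Fin (N + 1) × Fin R → ℝ :=
    fun s j => Real.sqrt (t s * μ s j.1 j.2 / lam j.1 j.2)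
  have hM := sum_inner_completedKraus (c := c) (y := fun s => sectorFamily deg (y s))
    (isUnitOn_sectorFamily hdeg hx) (fun s => isUnitOn_sectorFamily hdeg (hy s))
    (fun s j hj => by
      have : μ s j.1 j.2 = 0 := hj
      simp [c, this])
    (fun j hj => by
      have h0 : ∀ s, c s j ^ 2 = t s * μ s j.1 j.2 / lam j.1 j.2 := fun s =>
        Real.sq_sqrt (div_nonneg (hμ _ _ _) ((hlam _).2.1 _))
      simp only [h0, ← Finset.sum_div, ← hsum]
      exact div_self hj)
  have hbr := Convertible.of_alice (φ := φ) (ψ := ψ) hM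
    (commutesWithNumber_completedKraus c y x)
    (g := fun s α => match s with
      | none => 0
      | some s => if s.2 = α then t s else 0) ?_
  · have hg : (fun α => ∑ s : Option (κ × ι), (match s with
        | none => 0
        | some s => if s.2 = α then t s else 0)) = p := by
      funext α
      rw [Fintype.sum_option, Fintype.sum_prod_type]
      simp [t, ← Finset.sum_mul, hq1]
    rwa [hg] at hbr
  · rintro (- | s)
    · have h0 : actA (completedKraus c (fun s => sectorFamily deg (y s)) (sectorFamily deg x)
          none) ψ = 0 := by
        funext n
        simp only [actA]
        rw [hψ n R (hR1 n)]
        simp only [map_sum, map_smul, TensorProduct.map_tmul, LinearMap.id_apply]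
        refine Finset.sum_eq_zero fun i _ => ?_
        by_cases hi : lam n i = 0
        · simp only [hi, Real.sqrt_zero, Complex.ofReal_zero, zero_smul]
        · have := block_completedKraus_none hdeg c y x (hx n) hi
          simp only [deg, x] at this
          rw [this, TensorProduct.zero_tmul, smul_zero]
      rw [h0]
      exact convertible_zero
    · refine convertible_of_bob_rotation (ht s) (μ := μ s) (hφ s.2)
        (e := y s) (f := fun n i => f n i) (g := fun n i => f' s.2 n (σ s.1 n i))
        (b := fun n i => lam n i) (fun n => (hf n).comp Fin.val_injective)
        (hzero s) (fun n => (hf' s.2 n).comp (Fin.val_injective.comp (σ s.1 n).injective))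
        (fun n => ?_) fun n => ?_
      · rw [hφ' s.2 n R (hR2 s.2 n)]
        -- Permuting both Schmidt families and the coefficients by `σ` leaves `φ α` unchanged.
        exact (Equiv.sum_comp (σ s.1 n) fun i : Fin R =>
          ((Real.sqrt (mu s.2 n i) : ℝ) : ℂ) • (e' s.2 n i ⊗ₜ[ℂ] f' s.2 n i)).symm
      · simp only [actA]
        rw [hψ n R (hR1 n)]
        simp only [map_sum, map_smul, TensorProduct.map_tmul, LinearMap.id_apply]
        refine Finset.sum_congr rfl fun i _ => ?_
        by_cases hi : lam n i = 0
        · simp only [hi, hzero s n i hi, Real.sqrt_zero, Complex.ofReal_zero, zero_smul]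
        · have hB := block_familyOp_apply hdeg (c s) (y s) x (hx n) hi
          have hc : Real.sqrt (lam n i) * c s (n, i) = Real.sqrt (t s * μ s n i) := by
            rw [← Real.sqrt_mul ((hlam n).2.1 i), mul_div_cancel₀ _ hi]
          refine (congrArg (fun z => ((Real.sqrt (lam n i) : ℝ) : ℂ) • (z ⊗ₜ[ℂ] f n i)) hB).trans ?_
          rw [← TensorProduct.smul_tmul', smul_smul, ← Complex.ofReal_mul, hc]

end Sufficiency

end SSR

theorem mainTheorem2
    {HA : ℕ → Type*} [∀ n, NormedAddCommGroup (HA n)] [∀ n, InnerProductSpace ℂ (HA n)]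
    [∀ n, CompleteSpace (HA n)]
    {HB : ℕ → Type*} [∀ n, NormedAddCommGroup (HB n)] [∀ n, InnerProductSpace ℂ (HB n)]
    [∀ n, CompleteSpace (HB n)]
    {N : ℕ} {ι : Type*} [Fintype ι]
    (ψ : SSR.Vec HA HB N) (hψ : SSR.normSq ψ = 1)
    (lam : Fin (N + 1) → ℕ →₀ ℝ) (hlam : ∀ n, SSR.HasSchmidtCoeffs (ψ n) (lam n))
    (p : ι → ℝ) (hp : ∀ α, 0 ≤ p α) (hp1 : ∑ α, p α = 1)
    (φ : ι → SSR.Vec HA HB N) (hφ : ∀ α, SSR.normSq (φ α) = 1)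
    (mu : ι → Fin (N + 1) → ℕ →₀ ℝ) (hmu : ∀ α n, SSR.HasSchmidtCoeffs (φ α n) (mu α n)) :
    SSR.Convertible ψ p φ ↔ ∀ n, SSR.Majorized (lam n) (∑ α, p α • mu α n) :=
  ⟨fun h n => SSR.majorized_of_convertible hψ hlam hp1 hφ hmu h n,
    fun h => SSR.convertible_of_majorized hlam hp hp1 hφ hmu h⟩
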